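/- Let $g,t$ be positive integers and let $K$ be a set of positive integers. A $(gt,g,K,1)$ cyclic difference family is a family $\mathcal F$ of subsets of $\mathbb Z_{gt}$ (the base blocks) such that (1) $|B|\in K$ for every $B\in\mathcal F$; and (2) the multiset union $\Delta\mathcal F=\bigcup_{B\in\mathcal F}\Delta B$ of the difference lists $\Delta B=\{x-y : x,y\in B,\ x\neq y\}$ contains each element of $\mathbb Z_{gt}\setminus\{0,t,2t,\ldots,(g-1)t\}$ exactly once and contains no element of $\{0,t,2t,\ldots,(g-1)t\}$. **Lemma.** For every even integer $t\ge 4$ there exists a $(16t,16,\{3,5\},1)$ cyclic difference family. -/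

import Mathlib

/-- The list of differences `ΔB = {x - y : x, y ∈ B, x ≠ y}` of a block `B`, with multiplicities. -/
def CDF.differences {G : Type*} [AddCommGroup G] [DecidableEq G] (B : Finset G) : Multiset G :=
  B.offDiag.val.map fun p => p.1 - p.2

/-- `IsCyclicDifferenceFamily g t K F`: the family `F` of subsets (base blocks) of `ℤ/gtℤ` is a
`(gt, g, K, 1)`-cyclic difference family. Every base block has its size in `K`, and the list of all
differences of the base blocks consists of each element of `ℤ/gtℤ` outside the subgroup
`{0, t, 2t, …, (g-1)t}` exactly once, and of no element of that subgroup. -/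
structure IsCyclicDifferenceFamily (g t : ℕ) (K : Set ℕ) (F : Finset (Finset (ZMod (g * t)))) :
    Prop where
  card_mem : ∀ B ∈ F, B.card ∈ K
  count_eq_one : ∀ d : ZMod (g * t), (¬ ∃ i < g, d = ((i * t : ℕ) : ZMod (g * t))) →
    (∑ B ∈ F, CDF.differences B).count d = 1
  count_eq_zero : ∀ d : ZMod (g * t), (∃ i < g, d = ((i * t : ℕ) : ZMod (g * t))) →
    (∑ B ∈ F, CDF.differences B).count d = 0

namespace CDF

/-! The proof constructs the blocks explicitly, with integer entries in `[0, 8t)`. Differences come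
in pairs `±x`, so it suffices to hit each `x ≤ 8t` not divisible by `t`. Exactly `16t - 16` ordered
pairs are available, so hitting everything forces multiplicity one and leaves nothing for the
subgroup (`exists_family_of_covers`).

For `t ≥ 10` most blocks lie in two runs of triples. One is centred at `4t`, using small even
differences and an interval around `4t`; the other is centred near `20t/3`, using small odd
differences and an interval around that centre. A bounded number of sporadic blocks, of shape
depending on `t` mod 6, absorbs what is left. -/

/-- `x` is a difference of two entries of some list in `L`. -/
def Covers (L : List (List ℕ)) (x : ℕ) : Prop :=
  ∃ l ∈ L, ∃ p ∈ l, ∃ q ∈ l, p = q + x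

/-- The reduction modulo `n` of a list of natural numbers, as a block of `ℤ/n`. -/
def toBlock (n : ℕ) (l : List ℕ) : Finset (ZMod n) :=
  (l.map (Nat.cast : ℕ → ZMod n)).toFinset

lemma card_differences {G : Type*} [AddCommGroup G] [DecidableEq G] (B : Finset G) :
    (differences B).card = B.card * (B.card - 1) := by
  rw [differences, Multiset.card_map, Finset.card_val, Finset.offDiag_card, Nat.mul_sub_one]

lemma card_toBlock_le (n : ℕ) (l : List ℕ) : (toBlock n l).card ≤ l.length :=
  (List.toFinset_card_le _).trans_eq (List.length_map _)

lemma card_differences_toBlock_le (n : ℕ) (l : List ℕ) :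
    (differences (toBlock n l)).card ≤ l.length * (l.length - 1) := by
  rw [card_differences]
  exact Nat.mul_le_mul (card_toBlock_le n l) (Nat.sub_le_sub_right (card_toBlock_le n l) 1)

lemma mem_differences {G : Type*} [AddCommGroup G] [DecidableEq G] {B : Finset G} {d : G} :
    d ∈ differences B ↔ ∃ x ∈ B, ∃ y ∈ B, x ≠ y ∧ x - y = d := by
  simp [differences, Finset.mem_offDiag, and_assoc]

/-- If the differences of the blocks in `L` hit every half-difference outside the subgroup, and
there are no more of them than necessary, then the blocks form a cyclic difference family. -/
theorem exists_family_of_covers {g t : ℕ} {K : Set ℕ} (hg : 0 < g) (ht : 0 < t)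
    (L : List (List ℕ)) (hK : ∀ l ∈ L, l.length ∈ K)
    (hcard : (L.map fun l => l.length * (l.length - 1)).sum = g * t - g)
    (hcov : ∀ x, 0 < x → 2 * x ≤ g * t → ¬ t ∣ x → Covers L x) :
    ∃ F : Finset (Finset (ZMod (g * t))), IsCyclicDifferenceFamily g t K F := by
  classical
  have hn : 0 < g * t := Nat.mul_pos hg ht
  have : NeZero (g * t) := ⟨hn.ne'⟩
  set H : Finset (ZMod (g * t)) :=
    (Finset.range g).image fun i => ((i * t : ℕ) : ZMod (g * t)) with hH
  have memH : ∀ d : ZMod (g * t), d ∈ H ↔ ∃ i < g, d = ((i * t : ℕ) : ZMod (g * t)) := by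
    intro d
    simp only [hH, Finset.mem_image, Finset.mem_range, eq_comm]
  have hS : g * t - g ≤ Hᶜ.card := by
    have h1 : H.card ≤ g := Finset.card_image_le.trans_eq (Finset.card_range g)
    rw [Finset.card_compl, ZMod.card]
    omega
  set M' : Multiset (ZMod (g * t)) := (L.map fun l => differences (toBlock (g * t) l)).sum
  set F : Finset (Finset (ZMod (g * t))) := (L.map (toBlock (g * t))).toFinset with hF
  have hMM' : ∑ B ∈ F, differences B ≤ M' := by
    have hM' : M' = ((L.map (toBlock (g * t))).map differences).sum := by
      rw [List.map_map]; rfl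
    rw [hM', Finset.sum, hF, List.toFinset_val, Multiset.map_coe, Multiset.sum_coe]
    exact ((List.dedup_sublist _).map differences).sum_le_sum fun _ _ => Multiset.zero_le _
  have hSM : Hᶜ.val ≤ ∑ B ∈ F, differences B := by
    rw [Multiset.le_iff_subset Hᶜ.nodup]
    intro d hd
    have hd' : d ∉ H := by simpa using hd
    rw [memH] at hd'
    have hlt := ZMod.val_lt d
    have hdv : ((d.val : ℕ) : ZMod (g * t)) = d := ZMod.natCast_zmod_val d
    have hdvd : ¬ t ∣ d.val := by
      rintro ⟨i, hi⟩
      refine hd' ⟨i, ?_, ?_⟩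
      · rw [hi, mul_comm t i] at hlt
        exact lt_of_mul_lt_mul_right hlt ht.le
      · rw [mul_comm i t, ← hi, hdv]
    have hd0 : d ≠ 0 := by
      rintro rfl
      exact hdvd (by simp)
    have hv0 : 0 < d.val := Nat.pos_of_ne_zero fun h => hdvd (h ▸ dvd_zero t)
    have key : ∃ l ∈ L, ∃ p ∈ l, ∃ q ∈ l, (p : ZMod (g * t)) - q = d := by
      -- For a residue above half the modulus, cover `-d` and swap the two entries.
      rcases le_or_gt (2 * d.val) (g * t) with h | h
      · obtain ⟨l, hl, p, hp, q, hq, e⟩ := hcov d.val hv0 h hdvd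
        refine ⟨l, hl, p, hp, q, hq, ?_⟩
        rw [e, Nat.cast_add, hdv, add_sub_cancel_left]
      · obtain ⟨l, hl, p, hp, q, hq, e⟩ := hcov (g * t - d.val) (by omega) (by omega) (by
          rwa [Nat.dvd_sub_iff_right hlt.le (dvd_mul_left t g)])
        refine ⟨l, hl, q, hq, p, hp, ?_⟩
        rw [e, Nat.cast_add, Nat.cast_sub hlt.le, hdv, ZMod.natCast_self]
        ring
    obtain ⟨l, hl, p, hp, q, hq, e⟩ := key
    rw [Multiset.mem_sum]
    refine ⟨toBlock (g * t) l, by simpa [hF] using ⟨l, hl, rfl⟩, ?_⟩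
    rw [mem_differences]
    refine ⟨p, by simpa [toBlock] using ⟨p, hp, rfl⟩, q, by simpa [toBlock] using ⟨q, hq, rfl⟩,
      ?_, e⟩
    intro h
    exact hd0 (by rw [← e, h, sub_self])
  have hM'card : M'.card = (L.map fun l => (differences (toBlock (g * t) l)).card).sum := by
    exact (map_list_sum Multiset.cardHom _).trans (by rw [List.map_map]; rfl)
  have hM'le : M'.card ≤ g * t - g := by
    rw [hM'card, ← hcard]
    exact List.sum_le_sum fun l _ => card_differences_toBlock_le _ l
  -- Sandwich: `Hᶜ ≤ ∑ ≤ M'`, while `M'` has at most `g * t - g ≤ |Hᶜ|` elements.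
  have hMeq : Hᶜ.val = ∑ B ∈ F, differences B :=
    Multiset.eq_of_le_of_card_le hSM
      (((Multiset.card_le_card hMM').trans hM'le).trans hS)
  have hM'ge : g * t - g ≤ M'.card := hS.trans (Multiset.card_le_card (hSM.trans hMM'))
  refine ⟨F, ?_, ?_, ?_⟩
  · intro B hB
    simp only [hF, List.mem_toFinset, List.mem_map] at hB
    obtain ⟨l, hl, rfl⟩ := hB
    suffices h : (toBlock (g * t) l).card = l.length from h ▸ hK l hl
    by_contra hne
    have hlt : (toBlock (g * t) l).card < l.length := lt_of_le_of_ne (card_toBlock_le _ l) hne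
    -- A block losing an entry modulo `g * t` would leave too few differences.
    have : M'.card < g * t - g := by
      rw [hM'card, ← hcard]
      refine List.sum_lt_sum _ _ (fun l _ => card_differences_toBlock_le _ l) ⟨l, hl, ?_⟩
      have hpos : 0 < (toBlock (g * t) l).card := by
        obtain ⟨a, ha⟩ := List.exists_mem_of_length_pos (Nat.zero_lt_of_lt hlt)
        exact Finset.card_pos.2 ⟨a, by simpa [toBlock] using ⟨a, ha, rfl⟩⟩
      rw [card_differences]
      exact Nat.mul_lt_mul_of_lt_of_le hlt (by omega) (by omega)
    omega
  · intro d hd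
    rw [← memH] at hd
    rw [← hMeq]
    exact Multiset.count_eq_one_of_mem Hᶜ.nodup (by simpa using hd)
  · intro d hd
    rw [← memH] at hd
    rw [← hMeq]
    exact Multiset.count_eq_zero_of_notMem (by simpa using hd)

/-! ### Runs of triples -/

lemma covers_append {L₁ L₂ : List (List ℕ)} {x : ℕ} :
    Covers (L₁ ++ L₂) x ↔ Covers L₁ x ∨ Covers L₂ x := by
  simp only [Covers, List.mem_append, or_and_right, exists_or]

lemma covers_cons {l : List ℕ} {L : List (List ℕ)} {x : ℕ} :
    Covers (l :: L) x ↔ (∃ p ∈ l, ∃ q ∈ l, p = q + x) ∨ Covers L x := by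
  simp only [Covers, List.mem_cons, or_and_right, exists_or, exists_eq_left]

lemma not_covers_nil {x : ℕ} : ¬ Covers [] x := by simp [Covers]

/-- The blocks with differences `2 * i`, `c - i`, `c + i` for `a ≤ i < a + n`. -/
def evenSegment (c a n : ℕ) : List (List ℕ) :=
  (List.range n).map fun i => [0, 2 * (a + i), c + (a + i)]

/-- The blocks with differences `2 * i + 1`, `c - i`, `c + i + 1` for `a ≤ i < a + n`. -/
def oddSegment (c a n : ℕ) : List (List ℕ) :=
  (List.range n).map fun i => [0, 2 * (a + i) + 1, c + (a + i) + 1]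

lemma covers_evenSegment {c a n x : ℕ} (hc : a + n ≤ c)
    (h : (x % 2 = 0 ∧ 2 * a ≤ x ∧ x < 2 * (a + n)) ∨ (c + a ≤ x ∧ x < c + a + n) ∨
      (c < x + a + n ∧ x + a ≤ c)) : Covers (evenSegment c a n) x := by
  have key : ∃ i < n, x = 2 * (a + i) ∨ x = c + (a + i) ∨ c + (a + i) = 2 * (a + i) + x := by
    rcases h with h | h | h
    · exact ⟨x / 2 - a, by omega⟩
    · exact ⟨x - c - a, by omega⟩
    · exact ⟨c - x - a, by omega⟩
  obtain ⟨i, hi, h⟩ := key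
  refine ⟨_, List.mem_map_of_mem (List.mem_range.2 hi), ?_⟩
  simp only [List.mem_cons, List.not_mem_nil, or_false, exists_eq_or_imp, exists_eq_left]
  omega

lemma covers_oddSegment {c a n x : ℕ} (hc : a + n ≤ c)
    (h : (x % 2 = 1 ∧ 2 * a ≤ x ∧ x < 2 * (a + n)) ∨ (c + a < x ∧ x ≤ c + a + n) ∨
      (c < x + a + n ∧ x + a ≤ c)) : Covers (oddSegment c a n) x := by
  have key : ∃ i < n, x = 2 * (a + i) + 1 ∨ x = c + (a + i) + 1 ∨
      c + (a + i) + 1 = 2 * (a + i) + 1 + x := by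
    rcases h with h | h | h
    · exact ⟨x / 2 - a, by omega⟩
    · exact ⟨x - c - a - 1, by omega⟩
    · exact ⟨c - x - a, by omega⟩
  obtain ⟨i, hi, h⟩ := key
  refine ⟨_, List.mem_map_of_mem (List.mem_range.2 hi), ?_⟩
  simp only [List.mem_cons, List.not_mem_nil, or_false, exists_eq_or_imp, exists_eq_left]
  omega

lemma sum_evenSegment (c a n : ℕ) :
    ((evenSegment c a n).map fun l => l.length * (l.length - 1)).sum = n * 6 := by
  simp [evenSegment, Function.comp_def]

lemma sum_oddSegment (c a n : ℕ) :
    ((oddSegment c a n).map fun l => l.length * (l.length - 1)).sum = n * 6 := by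
  simp [oddSegment, Function.comp_def]

/-! ### Parametric families for `t ≥ 10` -/

lemma exists_family_six_mul_add_twelve (k : ℕ) :
    ∃ F : Finset (Finset (ZMod (16 * (6 * k + 12)))),
      IsCyclicDifferenceFamily 16 (6 * k + 12) {3, 5} F := by
  refine exists_family_of_covers (by norm_num) (by omega)
    -- The even run omits `i = t/2` and `i = t`, the odd run `i = 2k + 4` and `i = 4k + 7`, where a
    -- multiple of `t` would occur; the other gaps free differences for the sporadic blocks. As
    -- `16(t - 1) ≡ 2` mod 6, one 5-block (20 differences) is used beside the triples (6 each).
    (evenSegment (24 * k + 48) 2 (3 * k + 4) ++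
      evenSegment (24 * k + 48) (3 * k + 7) (3 * k + 5) ++
      evenSegment (24 * k + 48) (6 * k + 13) (2 * k + 1) ++
      oddSegment (40 * k + 79) 3 (2 * k + 1) ++
      oddSegment (40 * k + 79) (2 * k + 5) k ++
      oddSegment (40 * k + 79) (3 * k + 6) (k + 1) ++
      oddSegment (40 * k + 79) (4 * k + 8) (2 * k + 3) ++
      oddSegment (40 * k + 79) (6 * k + 12) (2 * k + 2) ++
      [[0, 1, 32 * k + 63], [0, 4 * k + 9, 44 * k + 87], [0, 6 * k + 11, 38 * k + 75],
        [0, 8 * k + 15, 48 * k + 95], [0, 12 * k + 23, 46 * k + 91],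
        [0, 16 * k + 29, 48 * k + 94], [0, 16 * k + 31, 43 * k + 85],
        [0, 16 * k + 32, 37 * k + 74], [0, 16 * k + 34, 40 * k + 81],
        [0, 3, 5, 16 * k + 33, 40 * k + 82]]) ?_ ?_ ?_
  · simp [or_imp, forall_and, evenSegment, oddSegment]
  · simp [sum_evenSegment, sum_oddSegment]
    omega
  · intro x h0 h1 hx
    by_contra h
    simp only [covers_append, covers_cons, not_covers_nil, not_or, List.mem_cons,
      List.not_mem_nil, or_false, exists_eq_or_imp, exists_eq_left] at h
    obtain ⟨⟨⟨⟨⟨⟨⟨⟨e1, e2⟩, e3⟩, o1⟩, o2⟩, o3⟩, o4⟩, o5⟩, s⟩ := h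
    replace e1 := mt (covers_evenSegment (by omega)) e1
    replace e2 := mt (covers_evenSegment (by omega)) e2
    replace e3 := mt (covers_evenSegment (by omega)) e3
    replace o1 := mt (covers_oddSegment (by omega)) o1
    replace o2 := mt (covers_oddSegment (by omega)) o2
    replace o3 := mt (covers_oddSegment (by omega)) o3
    replace o4 := mt (covers_oddSegment (by omega)) o4
    replace o5 := mt (covers_oddSegment (by omega)) o5
    -- Since `0 < x ≤ 8t`, only the multiples with `1 ≤ j ≤ 8` matter.
    have hne : ∀ j, x ≠ (6 * k + 12) * j := fun j hj => hx ⟨j, hj⟩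
    have h2 := hne 1
    have h3 := hne 2
    have h4 := hne 3
    have h5 := hne 4
    have h6 := hne 5
    have h7 := hne 6
    have h8 := hne 7
    have h9 := hne 8
    grind (splits := 60)

lemma exists_family_six_mul_add_fourteen (k : ℕ) :
    ∃ F : Finset (Finset (ZMod (16 * (6 * k + 14)))),
      IsCyclicDifferenceFamily 16 (6 * k + 14) {3, 5} F := by
  refine exists_family_of_covers (by norm_num) (by omega)
    (evenSegment (24 * k + 56) 3 (3 * k + 3) ++
      evenSegment (24 * k + 56) (3 * k + 9) (3 * k + 5) ++
      evenSegment (24 * k + 56) (6 * k + 15) (2 * k) ++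
      oddSegment (40 * k + 93) 2 (2 * k + 2) ++
      oddSegment (40 * k + 93) (2 * k + 5) k ++
      oddSegment (40 * k + 93) (3 * k + 8) (k + 1) ++
      oddSegment (40 * k + 93) (4 * k + 10) (4 * k + 4) ++
      [[0, 4, 16 * k + 33], [0, 4 * k + 9, 44 * k + 103], [0, 6 * k + 11, 43 * k + 99],
        [0, 6 * k + 12, 38 * k + 89], [0, 6 * k + 15, 43 * k + 101],
        [0, 6 * k + 16, 27 * k + 64], [0, 8 * k + 19, 32 * k + 74],
        [0, 16 * k + 30, 48 * k + 109], [0, 16 * k + 31, 32 * k + 71],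
        [0, 16 * k + 34, 40 * k + 92], [0, 16 * k + 36, 40 * k + 93],
        [0, 16 * k + 39, 48 * k + 111], [0, 16 * k + 41, 40 * k + 95],
        -- Here `16(t - 1) ≡ 4` mod 6, matched by two 5-blocks.
        [0, 2, 32 * k + 75, 32 * k + 78, 48 * k + 110],
        [0, 6 * k + 13, 27 * k + 62, 27 * k + 63, 43 * k + 100]]) ?_ ?_ ?_
  · simp [or_imp, forall_and, evenSegment, oddSegment]
  · simp [sum_evenSegment, sum_oddSegment]
    omega
  · intro x h0 h1 hx
    by_contra h
    simp only [covers_append, covers_cons, not_covers_nil, not_or, List.mem_cons,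
      List.not_mem_nil, or_false, exists_eq_or_imp, exists_eq_left] at h
    obtain ⟨⟨⟨⟨⟨⟨⟨e1, e2⟩, e3⟩, o1⟩, o2⟩, o3⟩, o4⟩, s⟩ := h
    replace e1 := mt (covers_evenSegment (by omega)) e1
    replace e2 := mt (covers_evenSegment (by omega)) e2
    replace e3 := mt (covers_evenSegment (by omega)) e3
    replace o1 := mt (covers_oddSegment (by omega)) o1
    replace o2 := mt (covers_oddSegment (by omega)) o2
    replace o3 := mt (covers_oddSegment (by omega)) o3
    replace o4 := mt (covers_oddSegment (by omega)) o4
    have hne : ∀ j, x ≠ (6 * k + 14) * j := fun j hj => hx ⟨j, hj⟩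
    have h2 := hne 1
    have h3 := hne 2
    have h4 := hne 3
    have h5 := hne 4
    have h6 := hne 5
    have h7 := hne 6
    have h8 := hne 7
    have h9 := hne 8
    grind (splits := 60)

lemma exists_family_six_mul_add_ten (k : ℕ) :
    ∃ F : Finset (Finset (ZMod (16 * (6 * k + 10)))),
      IsCyclicDifferenceFamily 16 (6 * k + 10) {3, 5} F := by
  refine exists_family_of_covers (by norm_num) (by omega)
    (evenSegment (24 * k + 40) 1 (3 * k + 4) ++
      evenSegment (24 * k + 40) (3 * k + 6) (3 * k + 4) ++
      evenSegment (24 * k + 40) (6 * k + 11) (2 * k) ++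
      oddSegment (40 * k + 66) 3 (2 * k) ++
      oddSegment (40 * k + 66) (2 * k + 4) k ++
      oddSegment (40 * k + 66) (3 * k + 5) k ++
      oddSegment (40 * k + 66) (4 * k + 7) (4 * k + 4) ++
      -- Here `16(t - 1)` is divisible by 6, so triples suffice.
      [[0, 1, 40 * k + 68], [0, 3, 16 * k + 25], [0, 5, 40 * k + 69],
        [0, 4 * k + 7, 44 * k + 73], [0, 6 * k + 9, 38 * k + 63], [0, 8 * k + 11, 44 * k + 72],
        [0, 8 * k + 13, 40 * k + 65], [0, 16 * k + 23, 48 * k + 78],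
        [0, 16 * k + 24, 32 * k + 53], [0, 16 * k + 26, 43 * k + 71],
        [0, 16 * k + 27, 37 * k + 62], [0, 16 * k + 28, 48 * k + 79]]) ?_ ?_ ?_
  · simp [or_imp, forall_and, evenSegment, oddSegment]
  · simp [sum_evenSegment, sum_oddSegment]
    omega
  · intro x h0 h1 hx
    by_contra h
    simp only [covers_append, covers_cons, not_covers_nil, not_or, List.mem_cons,
      List.not_mem_nil, or_false, exists_eq_or_imp, exists_eq_left] at h
    obtain ⟨⟨⟨⟨⟨⟨⟨e1, e2⟩, e3⟩, o1⟩, o2⟩, o3⟩, o4⟩, s⟩ := h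
    replace e1 := mt (covers_evenSegment (by omega)) e1
    replace e2 := mt (covers_evenSegment (by omega)) e2
    replace e3 := mt (covers_evenSegment (by omega)) e3
    replace o1 := mt (covers_oddSegment (by omega)) o1
    replace o2 := mt (covers_oddSegment (by omega)) o2
    replace o3 := mt (covers_oddSegment (by omega)) o3
    replace o4 := mt (covers_oddSegment (by omega)) o4
    have hne : ∀ j, x ≠ (6 * k + 10) * j := fun j hj => hx ⟨j, hj⟩
    have h2 := hne 1
    have h3 := hne 2
    have h4 := hne 3
    have h5 := hne 4
    have h6 := hne 5
    have h7 := hne 6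
    have h8 := hne 7
    have h9 := hne 8
    grind (splits := 60)

/-! ### Small cases `t = 4, 6, 8` -/

lemma exists_family_four :
    ∃ F : Finset (Finset (ZMod (16 * 4))), IsCyclicDifferenceFamily 16 4 {3, 5} F := by
  refine exists_family_of_covers (by norm_num) (by norm_num)
    [[0, 1, 26], [0, 2, 21], [0, 3, 13], [0, 5, 27], [0, 6, 15], [0, 7, 30], [0, 11, 29],
      [0, 14, 31]] (by simp) (by rfl) ?_
  intro x h0 h1
  replace h1 : x < 33 := by omega
  revert h0
  revert x
  unfold Covers
  decide

lemma exists_family_six :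
    ∃ F : Finset (Finset (ZMod (16 * 6))), IsCyclicDifferenceFamily 16 6 {3, 5} F := by
  refine exists_family_of_covers (by norm_num) (by norm_num)
    [[0, 1, 38], [0, 2, 45], [0, 5, 46], [0, 8, 39], [0, 9, 32], [0, 10, 44], [0, 11, 40],
      [0, 13, 27], [0, 15, 35], [0, 16, 33], [0, 19, 22, 26, 47]] (by simp) (by rfl) ?_
  intro x h0 h1
  replace h1 : x < 49 := by omega
  revert h0
  revert x
  unfold Covers
  decide

lemma exists_family_eight :
    ∃ F : Finset (Finset (ZMod (16 * 8))), IsCyclicDifferenceFamily 16 8 {3, 5} F := by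
  refine exists_family_of_covers (by norm_num) (by norm_num)
    [[0, 3, 33], [0, 6, 53], [0, 7, 57], [0, 9, 45], [0, 10, 44], [0, 11, 60], [0, 12, 51],
      [0, 13, 54], [0, 14, 52], [0, 15, 61], [0, 21, 43], [0, 26, 55], [0, 1, 28, 59, 63],
      [0, 5, 23, 25, 42]] (by simp) (by rfl) ?_
  intro x h0 h1
  replace h1 : x < 65 := by omega
  revert h0
  revert x
  unfold Covers
  decide

end CDF

theorem lemma4p16 (t : ℕ) (ht : 4 ≤ t) (heven : Even t) :
    ∃ F : Finset (Finset (ZMod (16 * t))), IsCyclicDifferenceFamily 16 t {3, 5} F := by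
  obtain ⟨m, rfl⟩ := heven.two_dvd
  have h : 2 * m = 4 ∨ 2 * m = 6 ∨ 2 * m = 8 ∨ (∃ k, 2 * m = 6 * k + 10) ∨
      (∃ k, 2 * m = 6 * k + 12) ∨ ∃ k, 2 * m = 6 * k + 14 := by
    obtain h | h | h : m % 3 = 2 ∨ m % 3 = 0 ∨ m % 3 = 1 := by omega
    · by_cases hm : m = 2
      · exact .inl (by omega)
      · exact .inr (.inr (.inr (.inl ⟨m / 3 - 1, by omega⟩)))
    · by_cases hm : m = 3
      · exact .inr (.inl (by omega))
      · exact .inr (.inr (.inr (.inr (.inl ⟨m / 3 - 2, by omega⟩))))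
    · by_cases hm : m = 4
      · exact .inr (.inr (.inl (by omega)))
      · exact .inr (.inr (.inr (.inr (.inr ⟨m / 3 - 2, by omega⟩))))
  rcases h with h | h | h | ⟨k, h⟩ | ⟨k, h⟩ | ⟨k, h⟩ <;> rw [h]
  · exact CDF.exists_family_four
  · exact CDF.exists_family_six
  · exact CDF.exists_family_eight
  · exact CDF.exists_family_six_mul_add_ten k
  · exact CDF.exists_family_six_mul_add_twelve k
  · exact CDF.exists_family_six_mul_add_fourteen k
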